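/- Let $F$ be a probability distribution on $\mathbb R$ with $\mathsf E[e^{tX}]<\infty$ for all $t\in\mathbb R$, where $X\sim F$. Let $X,X'\sim F$ be independent and suppose that $F$ has atoms, i.e. $\alpha:=\mathsf P(X=X')>0$. For every $n$ let $\Gamma_n$ be the random game with player set $[n]$ in which every player has the strategies $0,1$ and the payoffs $u_i(s)$, $i\in[n]$, $s\in\{0,1\}^n$, are i.i.d. with distribution $F$. Let $\mathrm{NE}(\Gamma_n)$ be the (random) set of pure Nash equilibria, that is, of the profiles $s$ such that no player can strictly increase his own payoff by switching his strategy while all others keep theirs. Put $\mathrm{ASU}(\Gamma_n,s)=\frac1n\sum_{i\in[n]}u_i(s)$, $$\mathrm{BEq}(\Gamma_n)=\max_{s\in \mathrm{NE}(\Gamma_n)}\mathrm{ASU}(\Gamma_n,s),\qquad \mathrm{WEq}(\Gamma_n)=\min_{s\in \mathrm{NE}(\Gamma_n)}\mathrm{ASU}(\Gamma_n,s).$$ Let $Y$ have the distribution function $\widetilde F(y)=\mathsf P(X\le y\mid X\ge X')$, and let $$x_{\mathrm{typ}}=\mathsf E[Y],\qquad \widetilde I(x)=\sup_{t\in\mathbb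 R}\bigl[xt-\log \mathsf E[e^{tY}]\bigr]\in[0,+\infty],$$ $$x_{\mathrm{beq}}=\inf\{x>x_{\mathrm{typ}}:\widetilde I(x)>\log(1+\alpha)\},\qquad x_{\mathrm{weq}}=\sup\{x<x_{\mathrm{typ}}:\widetilde I(x)>\log(1+\alpha)\}.$$ Then $\mathsf P(\mathrm{NE}(\Gamma_n)\ne\varnothing)\to1$ as $n\to\infty$ (so that it does not matter which values $\mathrm{BEq}$, $\mathrm{WEq}$ and the ratio in (ii) are given when there is no equilibrium), and (i) $(\mathrm{BEq}(\Gamma_n),\mathrm{WEq}(\Gamma_n))\to(x_{\mathrm{beq}},x_{\mathrm{weq}})$ in probability; (ii) for every $\varepsilon>0$, $$\frac{\bigl|\{s\in \mathrm{NE}(\Gamma_n):|\mathrm{ASU}(\Gamma_n,s)-x_{\mathrm{typ}}|<\varepsilon\}\bigr|}{|\mathrm{NE}(\Gamma_n)|}\to1\quad\text{in probability.}$$ -/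

import Mathlib

open MeasureTheory ProbabilityTheory Filter Topology

noncomputable section

namespace RandomGame

/-- A strategy profile of `n` players, each of whom has the two strategies `false`, `true`. -/
abbrev Profile (n : ℕ) : Type := Fin n → Bool

/-- A game with `n` players and two strategies each, given by the payoff `v i s` of every
player `i` at every profile `s`. -/
abbrev Game (n : ℕ) : Type := Fin n → Profile n → ℝ

/-- The profile in which player `i` alone switches to his other strategy. -/
def flip {n : ℕ} (s : Profile n) (i : Fin n) : Profile n := Function.update s i (!(s i))

/-- `s` is a pure Nash equilibrium: no player gains by a unilateral deviation. -/
def IsPNE {n : ℕ} (v : Game n) (s : Profile n) : Prop := ∀ i, v i (flip s i) ≤ v i s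

open Classical in
/-- The set of pure Nash equilibria. -/
def NE {n : ℕ} (v : Game n) : Finset (Profile n) := Finset.univ.filter (IsPNE v)

/-- Average social utility. -/
def ASU {n : ℕ} (v : Game n) (s : Profile n) : ℝ := (1 / (n : ℝ)) * ∑ i, v i s

/-- Largest average social utility of a pure Nash equilibrium: the supremum of a finite set, hence
a maximum, when there is an equilibrium (and `0` when there is none). -/
def BEq {n : ℕ} (v : Game n) : ℝ := sSup (ASU v '' (NE v : Set (Profile n)))

/-- Smallest average social utility of a pure Nash equilibrium (`0` when there is none). -/
def WEq {n : ℕ} (v : Game n) : ℝ := sInf (ASU v '' (NE v : Set (Profile n)))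

open Classical in
/-- The pure Nash equilibria whose average social utility lies within `ε` of `x`. -/
def NEnear {n : ℕ} (v : Game n) (x ε : ℝ) : Finset (Profile n) :=
  (NE v).filter (fun s => |ASU v s - x| < ε)

/-- `α = P(X = X')` for independent `X`, `X'` with law `μ`. -/
def tieProb (μ : Measure ℝ) : ℝ := (μ.prod μ).real {p | p.1 = p.2}

/-- The conditional law of `X` given `X ≥ X'`, for independent `X`, `X'` with law `μ`; its
distribution function is `y ↦ P(X ≤ y | X ≥ X')`. -/
def condLaw (μ : Measure ℝ) : Measure ℝ :=
  (ProbabilityTheory.cond (μ.prod μ) {p | p.2 ≤ p.1}).map Prod.fst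

/-- The large deviation rate `x ↦ sup_t (x t - log E[exp (t Y)])` of a law `ν` of `Y`. It may take
the value `+∞`. -/
def rate (ν : Measure ℝ) (x : ℝ) : EReal :=
  ⨆ t : ℝ, ((x * t - Real.log (∫ y, Real.exp (t * y) ∂ν) : ℝ) : EReal)

/-- The mean of the conditional law. -/
def xtyp (μ : Measure ℝ) : ℝ := ∫ y, y ∂(condLaw μ)

/-- The point above the mean where the rate of the conditional law crosses `log (1 + α)`. -/
def xbeq (μ : Measure ℝ) : ℝ :=
  sInf {x : ℝ | xtyp μ < x ∧ (Real.log (1 + tieProb μ) : EReal) < rate (condLaw μ) x}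

/-- The point below the mean where the rate of the conditional law crosses `log (1 + α)`. -/
def xweq (μ : Measure ℝ) : ℝ :=
  sSup {x : ℝ | x < xtyp μ ∧ (Real.log (1 + tieProb μ) : EReal) < rate (condLaw μ) x}

end RandomGame

end

/-! Let `intensity` be the measure giving each set `B` the expected number of equilibria with total
utility in `B`. At a fixed profile the equilibrium condition and the exponential of the total
utility both factor over the players, and the payoff pairs of distinct players are independent.
Summing over the `2 ^ n` profiles gives the moment generating function `exp (n * growth μ t)`, where
`growth μ` is `log (1 + α)` plus the cumulant generating function of `Y` (`mgf_intensity_eq_exp`).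
Its Legendre transform is `rate - log (1 + α)`, so `xbeq` and `xweq` are where the expected count
passes from exponentially large to exponentially small.

Beyond these points, Chernoff's and Markov's inequalities exclude equilibria (`tendsto_upper_tail`).
Inside them, exponential tilting makes the expected count exponentially large
(`eventually_exp_le_upper_tail`). The count then concentrates by Chebyshev's inequality: profiles
that are neither equal nor unilateral deviations of each other involve disjoint sets of payoffs, so
the variance is at most `n + 1` times the mean (`measureReal_occurrences_pneEvent_le_half`).

For (ii), the expected share of equilibria far from `xtyp` is exponentially small
(`tendsto_relative_far`), while the total count is at least half its mean with high probability. -/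

namespace RandomGame

/-! ### Large deviations for measures with moment generating function `exp (n * φ t)` -/

/-- Tilting at `t`, the mass that `W` puts on a window is bounded below by the tilted mass that is
left outside the two exponential tail bounds. -/
lemma mgf_le_window_add_tails {W : Measure ℝ} [IsFiniteMeasure W] {t h a r : ℝ} (hh : 0 ≤ h)
    (h₀ : Integrable (fun y => Real.exp (t * y)) W)
    (h₁ : Integrable (fun y => Real.exp ((t + h) * y)) W)
    (h₂ : Integrable (fun y => Real.exp ((t - h) * y)) W) :
    mgf id W t ≤ Real.exp (t * a + |t| * r) * W.real {y | |y - a| < r} +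
      Real.exp (-(h * (a + r))) * mgf id W (t + h) + Real.exp (h * (a - r)) * mgf id W (t - h) := by
  have hmeas : MeasurableSet {y : ℝ | |y - a| < r} :=
    measurableSet_lt (by fun_prop) measurable_const
  have hind : Integrable ({y : ℝ | |y - a| < r}.indicator (fun _ => (1 : ℝ))) W :=
    (integrable_const _).indicator hmeas
  have e : Real.exp (t * a + |t| * r) * W.real {y | |y - a| < r} +
      Real.exp (-(h * (a + r))) * mgf id W (t + h) + Real.exp (h * (a - r)) * mgf id W (t - h) =
      ∫ y, (Real.exp (t * a + |t| * r) * {y : ℝ | |y - a| < r}.indicator (fun _ => (1 : ℝ)) y +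
        Real.exp (-(h * (a + r))) * Real.exp ((t + h) * y) +
        Real.exp (h * (a - r)) * Real.exp ((t - h) * y)) ∂W := by
    rw [integral_add (by exact (hind.const_mul _).add (h₁.const_mul _)) (h₂.const_mul _),
      integral_add (hind.const_mul _) (h₁.const_mul _), integral_const_mul, integral_const_mul,
      integral_const_mul, integral_indicator hmeas]
    simp [mgf]
  rw [e, mgf]
  refine integral_mono h₀ (((hind.const_mul _).add (h₁.const_mul _)).add (h₂.const_mul _)) ?_
  intro y
  simp only [id, ← Real.exp_add]
  by_cases hy : |y - a| < r
  · rw [Set.indicator_of_mem (by exact hy), mul_one]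
    have : t * y ≤ t * a + |t| * r := by
      have : t * (y - a) ≤ |t| * r := (le_abs_self _).trans
        (by rw [abs_mul]; exact mul_le_mul_of_nonneg_left hy.le (abs_nonneg t))
      linarith
    have := Real.exp_le_exp.2 this
    linarith [Real.exp_pos (-(h * (a + r)) + (t + h) * y),
      Real.exp_pos (h * (a - r) + (t - h) * y)]
  · rw [Set.indicator_of_notMem (by exact hy), mul_zero]
    rcases le_abs.1 (not_lt.1 hy) with hy | hy
    · have : Real.exp (t * y) ≤ Real.exp (-(h * (a + r)) + (t + h) * y) :=
        Real.exp_le_exp.2 (by nlinarith)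
      linarith [Real.exp_pos (h * (a - r) + (t - h) * y)]
    · have : Real.exp (t * y) ≤ Real.exp (h * (a - r) + (t - h) * y) :=
        Real.exp_le_exp.2 (by nlinarith)
      linarith [Real.exp_pos (-(h * (a + r)) + (t + h) * y)]

/-- Supplies the small change `h` of the tilt that makes a tail exponent strictly negative. -/
lemma eventually_neg_of_hasDerivAt {f : ℝ → ℝ} {d : ℝ} (hf : HasDerivAt f d 0) (h0 : f 0 = 0)
    (hd : d < 0) : ∀ᶠ h in 𝓝[>] 0, f h < 0 := by
  have h1 : Tendsto (slope f 0) (𝓝[>] 0) (𝓝 d) :=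
    (hasDerivAt_iff_tendsto_slope.1 hf).mono_left
      (nhdsWithin_mono _ fun x (hx : 0 < x) => hx.ne')
  filter_upwards [h1.eventually (gt_mem_nhds hd), self_mem_nhdsWithin] with h hh hpos
  have hpos' : (0 : ℝ) < h := hpos
  rw [slope_def_field, h0, sub_zero, sub_zero] at hh
  by_contra hc
  exact absurd hh (not_lt.2 (div_nonneg (not_lt.1 hc) hpos'.le))

section Intensity

variable {W : ℕ → Measure ℝ} [∀ n, IsFiniteMeasure (W n)] {φ : ℝ → ℝ}

lemma integrable_exp_of_mgf_eq {V : Measure ℝ} {t a : ℝ} (h : mgf id V t = Real.exp a) :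
    Integrable (fun y => Real.exp (t * y)) V := by
  by_contra hc
  have : mgf id V t = 0 := mgf_undef hc
  exact (Real.exp_pos a).ne' (h.symm.trans this)

lemma tendsto_exp_nat_mul {c : ℝ} (hc : c < 0) :
    Tendsto (fun n : ℕ => Real.exp (n * c)) atTop (𝓝 0) :=
  Real.tendsto_exp_atBot.comp (tendsto_natCast_atTop_atTop.atTop_mul_const_of_neg hc)

lemma measureReal_Ici_le (hW : ∀ n t, mgf id (W n) t = Real.exp (n * φ t)) {t : ℝ} (ht : 0 ≤ t)
    (x : ℝ) (n : ℕ) : (W n).real {y | n * x ≤ y} ≤ Real.exp (n * (φ t - t * x)) := by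
  refine (measure_ge_le_exp_mul_mgf (X := id) (n * x) ht
    (integrable_exp_of_mgf_eq (hW n t))).trans (le_of_eq ?_)
  rw [hW, ← Real.exp_add]
  congr 1
  ring

/-- Weighted by `exp (t * y)`, the measure has mass `exp (n * φ t)` and concentrates near `n * φ' t
= n * x`: changing `t` by a small `h` either way makes both tail terms exponentially smaller than
that mass. On the remaining window the weight is at most `exp (n * (t * x + |t| * δ))`. -/
lemma eventually_exp_le_window (hW : ∀ n t, mgf id (W n) t = Real.exp (n * φ t)) {t x δ : ℝ}
    (hφ : HasDerivAt φ x t) (hδ : 0 < δ) :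
    ∀ᶠ n : ℕ in atTop, Real.exp (n * (φ t - t * x - |t| * δ)) / 2 ≤
      (W n).real {y | |y - n * x| < n * δ} := by
  have d1 : HasDerivAt (fun h => φ (t + h) - φ t - h * (x + δ)) (x - (x + δ)) 0 := by
    have h1 : HasDerivAt (fun h => φ (t + h)) x 0 := by
      apply HasDerivAt.comp_const_add
      simpa using hφ
    convert! (h1.sub_const (φ t)).sub ((hasDerivAt_id (0 : ℝ)).mul_const (x + δ)) using 1
    ring
  have d2 : HasDerivAt (fun h => φ (t - h) - φ t + h * (x - δ)) (-x + (x - δ)) 0 := by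
    have h1 : HasDerivAt (fun h => φ (t - h)) (-x) 0 := by
      apply HasDerivAt.comp_const_sub
      simpa using hφ
    convert! (h1.sub_const (φ t)).add ((hasDerivAt_id (0 : ℝ)).mul_const (x - δ)) using 1
    ring
  obtain ⟨h, ⟨f1, f2⟩, hh⟩ := (((eventually_neg_of_hasDerivAt d1 (by simp) (by linarith)).and
    (eventually_neg_of_hasDerivAt d2 (by simp) (by linarith))).and self_mem_nhdsWithin).exists
  have hh : 0 < h := hh
  filter_upwards [(tendsto_exp_nat_mul f1).eventually (gt_mem_nhds (by norm_num : (0 : ℝ) < 1 / 4)),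
    (tendsto_exp_nat_mul f2).eventually (gt_mem_nhds (by norm_num : (0 : ℝ) < 1 / 4))] with n g1 g2
  have key := mgf_le_window_add_tails (W := W n) (t := t) (h := h) (a := n * x) (r := n * δ) hh.le
    (integrable_exp_of_mgf_eq (hW n _)) (integrable_exp_of_mgf_eq (hW n _))
    (integrable_exp_of_mgf_eq (hW n _))
  rw [hW, hW, hW, ← Real.exp_add, ← Real.exp_add] at key
  have e1 : Real.exp (-(h * (n * x + n * δ)) + n * φ (t + h)) =
      Real.exp (n * φ t) * Real.exp (n * (φ (t + h) - φ t - h * (x + δ))) := by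
    rw [← Real.exp_add]; congr 1; ring
  have e2 : Real.exp (h * (n * x - n * δ) + n * φ (t - h)) =
      Real.exp (n * φ t) * Real.exp (n * (φ (t - h) - φ t + h * (x - δ))) := by
    rw [← Real.exp_add]; congr 1; ring
  rw [e1, e2] at key
  have hp := Real.exp_pos (n * φ t)
  have key2 : Real.exp (n * φ t) / 2 ≤ Real.exp (t * (n * x) + |t| * (n * δ)) *
      (W n).real {y | |y - n * x| < n * δ} := by nlinarith
  have e3 : Real.exp (n * φ t) = Real.exp (t * (n * x) + |t| * (n * δ)) *
      Real.exp (n * (φ t - t * x - |t| * δ)) := by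
    rw [← Real.exp_add]; congr 1; ring
  rw [e3, mul_div_assoc] at key2
  exact le_of_mul_le_mul_left key2 (Real.exp_pos _)

/-- If the Legendre transform of `φ` is non-positive at a point right of `x`, then the slope `x` is
attained. -/
lemma exists_hasDerivAt_eq {m x x' : ℝ} (hd : Differentiable ℝ φ) (h0 : HasDerivAt φ m 0)
    (hm : m < x) (hx : x < x') (hx' : ∀ t, t * x' ≤ φ t) :
    ∃ t, 0 < t ∧ HasDerivAt φ x t ∧ t * x < φ t := by
  obtain ⟨s, hs, hs'⟩ : ∃ s, 0 < s ∧ x < deriv φ s := by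
    by_contra! hc
    have hb : ∀ t, 0 ≤ t → φ t ≤ φ 0 + x * t := by
      intro t ht
      have := image_le_of_deriv_right_le_deriv_boundary (f := φ) (f' := deriv φ)
        (B := fun t => φ 0 + x * t) (B' := fun _ => x) (a := 0) (b := t)
        hd.continuous.continuousOn (fun y _ => (hd y).hasDerivAt.hasDerivWithinAt) (by simp)
        (by fun_prop)
        (fun y _ => by
          simpa using (((hasDerivAt_id y).const_mul x).const_add (φ 0)).hasDerivWithinAt)
        (fun y hy => by
          rcases hy.1.eq_or_lt with rfl | h
          · rw [h0.deriv]; exact hm.le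
          · exact hc y h)
      exact this ⟨ht, le_rfl⟩
    have h1 : 0 ≤ φ 0 := by simpa using hx' 0
    have hpos : 0 < x' - x := sub_pos.2 hx
    -- The point is chosen so that `t * (x' - x) = φ 0 + 1`, while the two bounds on `φ t` force `t
    -- * (x' - x) ≤ φ 0`.
    have h2 := hb ((φ 0 + 1) / (x' - x)) (by positivity)
    have h3 := hx' ((φ 0 + 1) / (x' - x))
    have h4 : (φ 0 + 1) / (x' - x) * (x' - x) = φ 0 + 1 := div_mul_cancel₀ _ hpos.ne'
    nlinarith
  -- Darboux's theorem: the derivative takes intermediate values without being assumed continuous.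
  obtain ⟨t, ht, ht'⟩ := exists_hasDerivWithinAt_eq_of_gt_of_lt (f := φ) (f' := deriv φ) hs.le
    (fun y _ => (hd y).hasDerivAt.hasDerivWithinAt) (m := x) (by rw [h0.deriv]; exact hm) hs'
  refine ⟨t, ht.1, ht' ▸ (hd t).hasDerivAt, ?_⟩
  have := hx' t
  nlinarith [ht.1]

/-- The points right of `m` at which the Legendre transform of `φ` is positive. -/
def upperSet (φ : ℝ → ℝ) (m : ℝ) : Set ℝ := {x | m < x ∧ ∃ t, φ t < t * x}

lemma tendsto_upper_tail (hW : ∀ n t, mgf id (W n) t = Real.exp (n * φ t)) {m : ℝ}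
    (hpos : 0 < φ 0) (hconv : ∀ t, φ 0 + t * m ≤ φ t) {x : ℝ} (hx : sInf (upperSet φ m) < x) :
    Tendsto (fun n : ℕ => (W n).real {y | n * x ≤ y}) atTop (𝓝 0) := by
  have hne : (upperSet φ m).Nonempty :=
    ⟨max m (φ 1) + 1, by linarith [le_max_left m (φ 1)], 1, by linarith [le_max_right m (φ 1)]⟩
  obtain ⟨z, ⟨hmz, t, ht⟩, hzx⟩ := exists_lt_of_csInf_lt hne hx
  -- For `t ≤ 0` the tangent at `0` gives `φ t ≥ φ 0 + t * m > t * z`, since `m < z`.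
  have ht0 : 0 < t := by
    by_contra hc
    nlinarith [hconv t]
  have h1 : φ t - t * x < 0 := by nlinarith
  exact squeeze_zero (fun n => measureReal_nonneg) (fun n => measureReal_Ici_le hW ht0.le x n)
    (tendsto_exp_nat_mul h1)

lemma eventually_exp_le_upper_tail (hW : ∀ n t, mgf id (W n) t = Real.exp (n * φ t)) {m : ℝ}
    (hd : Differentiable ℝ φ) (h0 : HasDerivAt φ m 0) (hpos : 0 < φ 0) {x : ℝ}
    (hx : x < sInf (upperSet φ m)) :
    ∃ c > 0, ∀ᶠ n : ℕ in atTop, Real.exp (n * c) / 2 ≤ (W n).real {y | n * x ≤ y} := by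
  suffices ∃ t x' δ, 0 < δ ∧ x ≤ x' - δ ∧ HasDerivAt φ x' t ∧ 0 < φ t - t * x' - |t| * δ by
    obtain ⟨t, x', δ, hδ, hxx, hder, hc⟩ := this
    refine ⟨_, hc, ?_⟩
    filter_upwards [eventually_exp_le_window hW hder hδ] with n hn
    refine hn.trans (measureReal_mono ?_)
    intro y (hy : |y - n * x'| < n * δ)
    have h1 := (abs_lt.1 hy).1
    have h2 := mul_le_mul_of_nonneg_left hxx (Nat.cast_nonneg (α := ℝ) n)
    show n * x ≤ y
    linarith
  rcases lt_or_ge x m with hxm | hxm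
  -- Left of `m` no tilt is needed: the untilted mass already concentrates near `n * m`.
  · exact ⟨0, m, m - x, by linarith, by linarith, h0, by simpa using hpos⟩
  · obtain ⟨x', h1, h2⟩ := exists_between hx
    obtain ⟨x'', h3, h4⟩ := exists_between h2
    have hnot : x'' ∉ upperSet φ m := notMem_of_lt_csInf h4 ⟨m, fun _ hz => hz.1.le⟩
    have hle : ∀ t, t * x'' ≤ φ t := by
      intro t
      by_contra hc
      exact hnot ⟨by linarith, t, not_le.1 hc⟩
    obtain ⟨t, ht, hder, hlt⟩ := exists_hasDerivAt_eq hd h0 (by linarith) h3 hle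
    -- The first bound keeps the window above `n * x`; the second spends only half of the slack `φ t
    -- - t * x'`.
    refine ⟨t, x', min (x' - x) ((φ t - t * x') / (2 * t)), ?_, ?_, hder, ?_⟩
    · exact lt_min (by linarith) (div_pos (by linarith) (by linarith))
    · linarith [min_le_left (x' - x) ((φ t - t * x') / (2 * t))]
    · rw [abs_of_pos ht]
      have h5 := mul_le_mul_of_nonneg_left
        (min_le_right (x' - x) ((φ t - t * x') / (2 * t))) ht.le
      have h6 : t * ((φ t - t * x') / (2 * t)) = (φ t - t * x') / 2 := by field_simp
      linarith

/-- The points left of `m` at which the Legendre transform of `φ` is positive. -/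
def lowerSet (φ : ℝ → ℝ) (m : ℝ) : Set ℝ := {x | x < m ∧ ∃ t, φ t < t * x}

/-- Reflection `y ↦ -y` exchanges the two tails, so the lower tail bounds follow from the upper
ones. -/
lemma sInf_upperSet_neg (φ : ℝ → ℝ) (m : ℝ) :
    sInf (upperSet (fun t => φ (-t)) (-m)) = -sSup (lowerSet φ m) := by
  rw [← Real.sInf_neg]
  congr 1
  ext x
  simp only [upperSet, lowerSet, Set.mem_ofPred_eq, Set.mem_neg]
  refine and_congr neg_lt ⟨fun ⟨t, ht⟩ => ⟨-t, by simpa using ht⟩,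
    fun ⟨t, ht⟩ => ⟨-t, by simpa using ht⟩⟩

lemma mgf_id_map_neg {V : ℕ → Measure ℝ} (hW : ∀ n t, mgf id (V n) t = Real.exp (n * φ t))
    (n : ℕ) (t : ℝ) : mgf id ((V n).map Neg.neg) t = Real.exp (n * φ (-t)) := by
  rw [mgf_id_map measurable_neg.aemeasurable, ← hW]
  exact mgf_neg

lemma map_neg_measureReal (V : Measure ℝ) (x : ℝ) (n : ℕ) :
    (V.map Neg.neg).real {y | n * (-x) ≤ y} = V.real {y | y ≤ n * x} := by
  rw [map_measureReal_apply measurable_neg (measurableSet_le measurable_const measurable_id')]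
  congr 1
  ext y
  simp

lemma tendsto_lower_tail (hW : ∀ n t, mgf id (W n) t = Real.exp (n * φ t)) {m : ℝ}
    (hpos : 0 < φ 0) (hconv : ∀ t, φ 0 + t * m ≤ φ t) {x : ℝ} (hx : x < sSup (lowerSet φ m)) :
    Tendsto (fun n : ℕ => (W n).real {y | y ≤ n * x}) atTop (𝓝 0) := by
  have := tendsto_upper_tail (W := fun n => (W n).map Neg.neg) (φ := fun t => φ (-t)) (m := -m)
    (mgf_id_map_neg hW) (by simpa using hpos) (fun t => by simpa using hconv (-t)) (x := -x)
    (by rw [sInf_upperSet_neg]; linarith)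
  simpa only [map_neg_measureReal] using this

lemma eventually_exp_le_lower_tail (hW : ∀ n t, mgf id (W n) t = Real.exp (n * φ t)) {m : ℝ}
    (hd : Differentiable ℝ φ) (h0 : HasDerivAt φ m 0) (hpos : 0 < φ 0) {x : ℝ}
    (hx : sSup (lowerSet φ m) < x) :
    ∃ c > 0, ∀ᶠ n : ℕ in atTop, Real.exp (n * c) / 2 ≤ (W n).real {y | y ≤ n * x} := by
  have := eventually_exp_le_upper_tail (W := fun n => (W n).map Neg.neg) (φ := fun t => φ (-t))
    (m := -m) (mgf_id_map_neg hW) (hd.comp differentiable_neg)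
    (by
      have h1 : HasDerivAt φ m (-0) := by simpa using h0
      have h2 := h1.comp (0 : ℝ) (hasDerivAt_neg (0 : ℝ))
      rw [mul_neg_one] at h2
      exact h2) (by simpa using hpos) (x := -x)
    (by rw [sInf_upperSet_neg]; linarith)
  simpa only [map_neg_measureReal] using this

/-- Relative to its total mass, `W n` puts exponentially little mass away from `n * m`. -/
lemma tendsto_relative_far (hW : ∀ n t, mgf id (W n) t = Real.exp (n * φ t)) {m : ℝ}
    (h0 : HasDerivAt φ m 0) {δ : ℝ} (hδ : 0 < δ) :
    Tendsto (fun n : ℕ => (W n).real {y | n * δ ≤ |y - n * m|} / (W n).real Set.univ)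
      atTop (𝓝 0) := by
  have d1 : HasDerivAt (fun h => φ h - φ 0 - h * (m + δ)) (m - (m + δ)) 0 := by
    convert! (h0.sub_const (φ 0)).sub ((hasDerivAt_id (0 : ℝ)).mul_const (m + δ)) using 1
    ring
  have d2 : HasDerivAt (fun h => φ (-h) - φ 0 + h * (m - δ)) (-m + (m - δ)) 0 := by
    have h1 : HasDerivAt φ m (-0) := by simpa using h0
    have h2 := h1.comp (0 : ℝ) (hasDerivAt_neg (0 : ℝ))
    rw [mul_neg_one] at h2
    convert! (h2.sub_const (φ 0)).add ((hasDerivAt_id (0 : ℝ)).mul_const (m - δ)) using 1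
    ring
  obtain ⟨h, ⟨f1, f2⟩, hh⟩ := (((eventually_neg_of_hasDerivAt d1 (by simp) (by linarith)).and
    (eventually_neg_of_hasDerivAt d2 (by simp) (by linarith))).and self_mem_nhdsWithin).exists
  have hh : 0 < h := hh
  refine squeeze_zero (fun n => by positivity) (fun n => ?_)
    (by simpa using (tendsto_exp_nat_mul f1).add (tendsto_exp_nat_mul f2))
  have huniv : (W n).real Set.univ = Real.exp (n * φ 0) := by rw [← hW, mgf_zero']
  rw [huniv, div_le_iff₀ (Real.exp_pos _)]
  have hsub : {y : ℝ | n * δ ≤ |y - n * m|} ⊆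
      {y | n * (m + δ) ≤ y} ∪ {y | n * (-(m - δ)) ≤ -y} := by
    intro y (hy : n * δ ≤ |y - n * m|)
    rcases le_abs.1 hy with h | h
    · left
      show n * (m + δ) ≤ y
      linarith
    · right
      show n * (-(m - δ)) ≤ -y
      linarith
  have u1 := measureReal_Ici_le hW hh.le (m + δ) n
  have u2 := measureReal_Ici_le (W := fun n => (W n).map Neg.neg) (mgf_id_map_neg hW) hh.le
    (-(m - δ)) n
  rw [map_measureReal_apply measurable_neg (measurableSet_le measurable_const measurable_id')] at u2
  refine (measureReal_mono hsub).trans ((measureReal_union_le _ _).trans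
    ((add_le_add u1 u2).trans (le_of_eq ?_)))
  rw [add_mul, ← Real.exp_add, ← Real.exp_add]
  congr 2 <;> ring

end Intensity
-- Second moment method under local dependence
section SecondMoment

variable {Ω ι : Type*} [Fintype ι]

/-- The number of the events `E` that occur. -/
noncomputable def occurrences (E : ι → Set Ω) (ω : Ω) : ℝ :=
  ∑ s, (E s).indicator (fun _ => (1 : ℝ)) ω

lemma occurrences_nonneg (E : ι → Set Ω) (ω : Ω) : 0 ≤ occurrences E ω :=
  Finset.sum_nonneg fun _ _ => Set.indicator_nonneg (fun _ _ => zero_le_one) _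

variable [MeasurableSpace Ω] {P : Measure Ω} [IsProbabilityMeasure P]

lemma integrable_occurrences {E : ι → Set Ω} (hE : ∀ s, MeasurableSet (E s)) :
    Integrable (occurrences E) P :=
  integrable_finsetSum _ fun s _ => (integrable_const (1 : ℝ)).indicator (hE s)

lemma integral_occurrences {E : ι → Set Ω} (hE : ∀ s, MeasurableSet (E s)) :
    ∫ ω, occurrences E ω ∂P = ∑ s, P.real (E s) := by
  unfold occurrences
  rw [integral_finsetSum _ fun s _ => (integrable_const (1 : ℝ)).indicator (hE s)]
  exact Finset.sum_congr rfl fun s _ => by rw [integral_indicator (hE s)]; simp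

/-- Chebyshev's inequality for a sum of indicators with a dependency neighbourhood of at most `d`
events for each event. -/
lemma measureReal_occurrences_le_half [DecidableEq ι] {E : ι → Set Ω}
    (hE : ∀ s, MeasurableSet (E s))
    {nbhd : ι → Finset ι} {d : ℕ} (hd : ∀ s, (nbhd s).card ≤ d)
    (hind : ∀ s s', s' ∉ nbhd s → P.real (E s ∩ E s') = P.real (E s) * P.real (E s'))
    (hpos : 0 < ∑ s, P.real (E s)) :
    P.real {ω | occurrences E ω ≤ (∑ s, P.real (E s)) / 2} ≤ 4 * d / ∑ s, P.real (E s) := by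
  set m := ∑ s, P.real (E s) with hm
  have hI := integrable_occurrences (P := P) hE
  have hsq : ∀ ω, occurrences E ω ^ 2 =
      ∑ s, ∑ s', (E s ∩ E s').indicator (fun _ => (1 : ℝ)) ω := by
    intro ω
    rw [sq, occurrences, Finset.sum_mul_sum]
    refine Finset.sum_congr rfl fun s _ => Finset.sum_congr rfl fun s' _ => ?_
    by_cases h1 : ω ∈ E s <;> by_cases h2 : ω ∈ E s' <;> simp [h1, h2]
  have hI2' : ∀ s s', Integrable ((E s ∩ E s').indicator (fun _ => (1 : ℝ))) P := fun s s' =>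
    (integrable_const (1 : ℝ)).indicator ((hE s).inter (hE s'))
  have hI2 : Integrable (fun ω => occurrences E ω ^ 2) P := by
    simp_rw [hsq]
    exact integrable_finsetSum _ fun s _ => integrable_finsetSum _ fun s' _ => hI2' s s'
  have hsecond : ∫ ω, occurrences E ω ^ 2 ∂P ≤ d * m + m ^ 2 := by
    simp_rw [hsq]
    rw [integral_finsetSum _ fun s _ => integrable_finsetSum _ fun s' _ => hI2' s s']
    have : ∀ s, ∫ ω, ∑ s', (E s ∩ E s').indicator (fun _ => (1 : ℝ)) ω ∂P ≤
        d * P.real (E s) + P.real (E s) * m := by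
      intro s
      rw [integral_finsetSum _ fun s' _ => hI2' s s']
      have e : ∀ s', ∫ ω, (E s ∩ E s').indicator (fun _ => (1 : ℝ)) ω ∂P =
          P.real (E s ∩ E s') := fun s' => by
        rw [integral_indicator ((hE s).inter (hE s'))]; simp
      simp_rw [e]
      -- A dependent pair costs at most `P (E s)`; adding the product in every case lets the second
      -- terms sum to exactly `m ^ 2`.
      have b : ∀ s', P.real (E s ∩ E s') ≤
          (if s' ∈ nbhd s then P.real (E s) else 0) + P.real (E s) * P.real (E s') := by
        intro s'
        split_ifs with h
        · have := measureReal_mono (μ := P) (Set.inter_subset_left (s := E s) (t := E s'))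
          have : 0 ≤ P.real (E s) * P.real (E s') := by positivity
          linarith
        · rw [hind s s' h, zero_add]
      refine (Finset.sum_le_sum fun s' _ => b s').trans ?_
      rw [Finset.sum_add_distrib, ← Finset.mul_sum, Finset.sum_ite_mem, Finset.univ_inter,
        Finset.sum_const, nsmul_eq_mul]
      have : ((nbhd s).card : ℝ) ≤ d := by exact_mod_cast hd s
      have := mul_le_mul_of_nonneg_right this (measureReal_nonneg (μ := P) (s := E s))
      linarith
    refine (Finset.sum_le_sum fun s _ => this s).trans (le_of_eq ?_)
    rw [Finset.sum_add_distrib, ← Finset.mul_sum, ← Finset.sum_mul, ← hm, sq]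
  have hvar : ∫ ω, (occurrences E ω - m) ^ 2 ∂P ≤ d * m := by
    have e : ∀ ω, (occurrences E ω - m) ^ 2 =
        occurrences E ω ^ 2 - 2 * m * occurrences E ω + m ^ 2 := fun ω => by ring
    simp_rw [e]
    rw [integral_add (by exact hI2.sub (hI.const_mul _)) (integrable_const _),
      integral_sub hI2 (hI.const_mul _), integral_const_mul, integral_occurrences hE, ← hm]
    simp
    nlinarith
  have hIv : Integrable (fun ω => (occurrences E ω - m) ^ 2) P := by
    have e : ∀ ω, (occurrences E ω - m) ^ 2 =
        occurrences E ω ^ 2 - 2 * m * occurrences E ω + m ^ 2 := fun ω => by ring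
    simp_rw [e]
    exact (hI2.sub (hI.const_mul _)).add (integrable_const _)
  have hmarkov := mul_meas_ge_le_integral_of_nonneg (μ := P)
    (Eventually.of_forall fun ω => sq_nonneg (occurrences E ω - m)) hIv (m ^ 2 / 4)
  have hsub : P.real {ω | occurrences E ω ≤ m / 2} ≤
      P.real {ω | m ^ 2 / 4 ≤ (occurrences E ω - m) ^ 2} := by
    refine measureReal_mono fun ω (hω : occurrences E ω ≤ m / 2) => ?_
    show m ^ 2 / 4 ≤ (occurrences E ω - m) ^ 2
    nlinarith
  rw [le_div_iff₀ hpos]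
  have h1 : P.real {ω | occurrences E ω ≤ m / 2} * (m ^ 2 / 4) ≤ d * m := by
    have := mul_le_mul_of_nonneg_right hsub (by positivity : 0 ≤ m ^ 2 / 4)
    linarith
  have h2 : (P.real {ω | occurrences E ω ≤ m / 2} * m) * m ≤ (4 * d) * m := by nlinarith
  exact le_of_mul_le_mul_right h2 hpos

lemma mul_measureReal_le_occurrences_le {E : ι → Set Ω} (hE : ∀ s, MeasurableSet (E s)) (c : ℝ) :
    c * P.real {ω | c ≤ occurrences E ω} ≤ ∑ s, P.real (E s) := by
  rw [← integral_occurrences hE]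
  exact mul_meas_ge_le_integral_of_nonneg (Eventually.of_forall fun ω => occurrences_nonneg E ω)
    (integrable_occurrences hE) c

end SecondMoment

/-! ### Dependence between equilibrium events -/

section Flip

variable {n : ℕ}

lemma flip_ne (s : Profile n) (i : Fin n) : flip s i ≠ s := fun h => by
  have := congrFun h i
  simp [flip] at this

lemma flip_flip (s : Profile n) (i : Fin n) : flip (flip s i) i = s := by
  simp [flip]

/-- A profile together with its unilateral deviations. -/
def closedNbhd (s : Profile n) : Finset (Profile n) := insert s (Finset.univ.image (flip s))

lemma card_closedNbhd_le (s : Profile n) : (closedNbhd s).card ≤ n + 1 := by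
  refine (Finset.card_insert_le _ _).trans (Nat.add_le_add_right ?_ 1)
  exact Finset.card_image_le.trans (by simp)

/-- The payoffs on which the event that `s` is an equilibrium and its utility depend. -/
def relevant (s : Profile n) : Set (Fin n × Profile n) := {q | q.2 = s ∨ q.2 = flip s q.1}

/-- A shared payoff belongs to one player `i`, so both profiles lie in the same pair `{r, flip r
i}`. -/
lemma disjoint_relevant {s s' : Profile n} (h : s' ∉ closedNbhd s) :
    Disjoint (relevant s) (relevant s') := by
  simp only [closedNbhd, Finset.mem_insert, Finset.mem_image, Finset.mem_univ, true_and,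
    not_or, not_exists] at h
  rw [Set.disjoint_left]
  rintro ⟨i, r⟩ (h1 | h1) (h2 | h2) <;> simp only at h1 h2
  · exact h.1 (h2.symm.trans h1)
  · exact h.2 i (by rw [← h1, h2, flip_flip])
  · exact h.2 i (by rw [← h1, h2])
  · exact h.1 (by rw [← flip_flip s' i, ← h2, h1, flip_flip])

end Flip

section Event

variable {n : ℕ} {Ω : Type*}

/-- The event that `s` is an equilibrium and that the total utility at `s` lies in `B`. -/
def pneEvent (u : Fin n → Profile n → Ω → ℝ) (B : Set ℝ) (s : Profile n) : Set Ω :=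
  {ω | IsPNE (fun i r => u i r ω) s ∧ ∑ i, u i s ω ∈ B}

/-- The σ-algebra is arbitrary and only the relevant payoffs need be measurable, so it may be the
one they generate, as the independence argument requires. -/
lemma measurableSet_pneEvent {m : MeasurableSpace Ω} {u : Fin n → Profile n → Ω → ℝ} {B : Set ℝ}
    (hB : MeasurableSet B) {s : Profile n}
    (hu : ∀ q ∈ relevant s, Measurable (u q.1 q.2)) : MeasurableSet (pneEvent u B s) := by
  have h1 : ∀ i, Measurable (u i s) := fun i => hu (i, s) (Or.inl rfl)
  have h2 : ∀ i, Measurable (u i (flip s i)) := fun i => hu (i, flip s i) (Or.inr rfl)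
  have : pneEvent u B s = (⋂ i, {ω | u i (flip s i) ω ≤ u i s ω}) ∩
      (fun ω => ∑ i, u i s ω) ⁻¹' B := by
    ext ω
    simp [pneEvent, IsPNE]
  rw [this]
  exact (MeasurableSet.iInter fun i => measurableSet_le (h2 i) (h1 i)).inter
    ((Finset.measurable_sum _ fun i _ => h1 i) hB)

variable [mΩ : MeasurableSpace Ω] {P : Measure Ω} {u : Fin n → Profile n → Ω → ℝ}

lemma measureReal_pneEvent_inter (hm : ∀ i s, Measurable (u i s))
    (hindep : iIndepFun (fun q : Fin n × Profile n => u q.1 q.2) P) {B : Set ℝ}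
    (hB : MeasurableSet B) {s s' : Profile n} (h : s' ∉ closedNbhd s) :
    P.real (pneEvent u B s ∩ pneEvent u B s') =
      P.real (pneEvent u B s) * P.real (pneEvent u B s') := by
  have key := indep_iSup_of_disjoint
    (m := fun q : Fin n × Profile n => MeasurableSpace.comap (u q.1 q.2) inferInstance)
    (fun q => (hm q.1 q.2).comap_le) hindep.iIndep (disjoint_relevant h)
  have hmeas : ∀ r, MeasurableSet[⨆ q ∈ relevant r,
      MeasurableSpace.comap (u q.1 q.2) inferInstance] (pneEvent u B r) := fun r =>
    measurableSet_pneEvent (m := ⨆ q ∈ relevant r,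
      MeasurableSpace.comap (u q.1 q.2) inferInstance) hB fun q hq =>
      (comap_measurable (u q.1 q.2)).mono
        (le_iSup₂ (f := fun (q : Fin n × Profile n) (_ : q ∈ relevant r) =>
          MeasurableSpace.comap (u q.1 q.2) inferInstance) q hq) le_rfl
  have := (Indep_iff _ _ _).1 key _ _ (hmeas s) (hmeas s')
  simp only [measureReal_def, this, ENNReal.toReal_mul]

lemma measureReal_occurrences_pneEvent_le_half [IsProbabilityMeasure P]
    (hm : ∀ i s, Measurable (u i s))
    (hindep : iIndepFun (fun q : Fin n × Profile n => u q.1 q.2) P) {B : Set ℝ}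
    (hB : MeasurableSet B) (hpos : 0 < ∑ s, P.real (pneEvent u B s)) :
    P.real {ω | occurrences (pneEvent u B) ω ≤ (∑ s, P.real (pneEvent u B s)) / 2} ≤
      4 * (n + 1 : ℕ) / ∑ s, P.real (pneEvent u B s) :=
  measureReal_occurrences_le_half (fun _ => measurableSet_pneEvent hB fun q _ => hm q.1 q.2)
    card_closedNbhd_le (fun _ _ h => measureReal_pneEvent_inter hm hindep hB h) hpos

end Event
-- Exponential moments of the intensity
section Curry

variable {Ω ι : Type*} {κ : ι → Type*} [MeasurableSpace Ω] {P : Measure Ω}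
  [IsProbabilityMeasure P] {𝓧 : (i : ι) → κ i → Type*} [∀ i j, MeasurableSpace (𝓧 i j)]

/-- Blocks of a family of independent random variables are independent. -/
lemma iIndepFun_curry {X : (i : ι) → (j : κ i) → Ω → 𝓧 i j} (mX : ∀ i j, Measurable (X i j))
    (h : iIndepFun (fun (p : (i : ι) × κ i) ω => X p.1 p.2 ω) P) :
    iIndepFun (fun i ω => (X i · ω)) P := by
  have : ∀ i j, IsProbabilityMeasure (P.map (X i j)) :=
    fun i j => Measure.isProbabilityMeasure_map (mX i j).aemeasurable
  have h2 : ∀ i, iIndepFun (X i) P := fun i =>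
    h.precomp (g := fun j : κ i => (⟨i, j⟩ : (i : ι) × κ i)) sigma_mk_injective
  have e : (MeasurableEquiv.piCurry 𝓧) ∘ (fun ω p => X p.1 p.2 ω) = fun ω i j => X i j ω := by
    ext; simp [Sigma.curry]
  -- Independence says that the joint law is a product measure, and currying turns a product over
  -- pairs into a product of products.
  rw [iIndepFun_iff_map_fun_eq_infinitePi_map (by fun_prop)] at h ⊢
  have h3 := congrArg (Measure.map (MeasurableEquiv.piCurry 𝓧)) h
  rw [Measure.map_map (by fun_prop) (by fun_prop), e,
    Measure.infinitePi_map_piCurry (fun i j => P.map (X i j))] at h3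
  rw [h3]
  congrm Measure.infinitePi fun i => ?_
  rw [(iIndepFun_iff_map_fun_eq_infinitePi_map (by fun_prop)).1 (h2 i)]

end Curry

/-- The exponential moment `E[exp (t X); X' ≤ X]` for independent `X`, `X'` with law `μ`. -/
noncomputable def tieMoment (μ : Measure ℝ) (t : ℝ) : ℝ :=
  ∫ p in {p : ℝ × ℝ | p.2 ≤ p.1}, Real.exp (t * p.1) ∂(μ.prod μ)

section Game

variable {n : ℕ} {Ω : Type*} [MeasurableSpace Ω] {P : Measure Ω} [IsProbabilityMeasure P]
  {μ : Measure ℝ} {u : Fin n → Profile n → Ω → ℝ}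

/-- The indicator of equilibrium times the exponential of the total utility is a product over
players, the factor of `i` depending only on the payoffs of `i` at `s` and at `flip s i`. -/
lemma mgf_sum_restrict_isPNE (hm : ∀ i s, Measurable (u i s)) (hlaw : ∀ i s, P.map (u i s) = μ)
    (hindep : iIndepFun (fun q : Fin n × Profile n => u q.1 q.2) P) (s : Profile n) (t : ℝ) :
    mgf (fun ω => ∑ i, u i s ω) (P.restrict {ω | IsPNE (fun i r => u i r ω) s}) t =
      tieMoment μ t ^ n := by
  have hmeas : MeasurableSet {p : ℝ × ℝ | p.2 ≤ p.1} :=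
    measurableSet_le measurable_snd measurable_fst
  have hmE : MeasurableSet {ω | IsPNE (fun i r => u i r ω) s} := by
    simpa [pneEvent] using measurableSet_pneEvent (u := u) (s := s) MeasurableSet.univ
      (fun q _ => hm q.1 q.2)
  set X : Fin n → Bool → Ω → ℝ := fun i b => u i (cond b s (flip s i)) with hX
  have hg : Function.Injective (fun p : (_ : Fin n) × Bool => (p.1, cond p.2 s (flip s p.1))) := by
    rintro ⟨i, b⟩ ⟨i', b'⟩ h
    obtain ⟨rfl, h2⟩ := Prod.mk.inj h
    cases b <;> cases b' <;> simp_all [flip_ne, (flip_ne _ _).symm]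
  have hXind : iIndepFun (fun (p : (_ : Fin n) × Bool) ω => X p.1 p.2 ω) P := hindep.precomp hg
  have hXm : ∀ i b, Measurable (X i b) := fun i b => hm _ _
  set f : (Bool → ℝ) → ℝ := fun x =>
    {p : ℝ × ℝ | p.2 ≤ p.1}.indicator (fun p => Real.exp (t * p.1)) (x true, x false) with hf
  have hind : Measurable ({p : ℝ × ℝ | p.2 ≤ p.1}.indicator fun p => Real.exp (t * p.1)) :=
    Measurable.indicator (by fun_prop) hmeas
  have hfm : Measurable f := hind.comp (by fun_prop)
  have key := (iIndepFun_curry hXm hXind).integral_fun_prod_comp (f := fun _ => f)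
    (fun i => (measurable_pi_lambda _ fun b => hXm i b).aemeasurable)
    (fun i => hfm.aestronglyMeasurable)
  have hone : ∀ i, ∫ ω, f (X i · ω) ∂P = tieMoment μ t := by
    intro i
    have hpair : IndepFun (X i true) (X i false) P :=
      hXind.indepFun (i := ⟨i, true⟩) (j := ⟨i, false⟩) (by simp)
    have hmap := (indepFun_iff_map_prod_eq_prod_map_map (hXm i true).aemeasurable
      (hXm i false).aemeasurable).1 hpair
    rw [hlaw, hlaw] at hmap
    rw [tieMoment, ← integral_indicator hmeas, ← hmap, integral_map
      ((hXm i true).prodMk (hXm i false)).aemeasurable hind.aestronglyMeasurable]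
  simp_rw [hone] at key
  rw [Finset.prod_const, Finset.card_univ, Fintype.card_fin] at key
  rw [← key, mgf, ← integral_indicator hmE]
  refine integral_congr_ae (Eventually.of_forall fun ω => ?_)
  by_cases h : IsPNE (fun i r => u i r ω) s
  · have h' : ∀ i, u i (flip s i) ω ≤ u i s ω := h
    simp only [Set.indicator_of_mem (show ω ∈ {ω | IsPNE (fun i r => u i r ω) s} from h), hf]
    rw [Finset.mul_sum, Real.exp_sum]
    refine Finset.prod_congr rfl fun i _ => ?_
    rw [Set.indicator_of_mem (by exact h' i)]
    rfl
  · rw [Set.indicator_of_notMem (by exact h)]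
    obtain ⟨i, hi⟩ := not_forall.1 h
    refine (Finset.prod_eq_zero (Finset.mem_univ i) ?_).symm
    exact Set.indicator_of_notMem (by exact hi) _

/-- The expected number of equilibria whose total utility lies in a given set. -/
noncomputable def intensity (u : Fin n → Profile n → Ω → ℝ) (P : Measure Ω) : Measure ℝ :=
  ∑ s, (P.restrict {ω | IsPNE (fun i r => u i r ω) s}).map (fun ω => ∑ i, u i s ω)

instance : IsFiniteMeasure (intensity u P) := by
  unfold intensity
  infer_instance

lemma intensity_real_apply (hm : ∀ i s, Measurable (u i s)) {B : Set ℝ}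
    (hB : MeasurableSet B) :
    (intensity u P).real B = ∑ s, P.real (pneEvent u B s) := by
  have hsum : ∀ s, Measurable (fun ω => ∑ i, u i s ω) := fun s =>
    Finset.measurable_sum _ fun i _ => hm i s
  rw [intensity, measureReal_def, Measure.finsetSum_apply, ENNReal.toReal_sum (by simp)]
  refine Finset.sum_congr rfl fun s _ => ?_
  rw [Measure.map_apply (hsum s) hB, Measure.restrict_apply (hsum s hB), measureReal_def]
  congr 2
  ext ω
  simp [pneEvent, and_comm]

lemma mgf_intensity (hm : ∀ i s, Measurable (u i s)) (hlaw : ∀ i s, P.map (u i s) = μ)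
    (hindep : iIndepFun (fun q : Fin n × Profile n => u q.1 q.2) P) {t : ℝ}
    (ht : 0 < tieMoment μ t) :
    mgf id (intensity u P) t = (2 * tieMoment μ t) ^ n := by
  have hsum : ∀ s, Measurable (fun ω => ∑ i, u i s ω) := fun s =>
    Finset.measurable_sum _ fun i _ => hm i s
  have h1 : ∀ s, mgf id ((P.restrict {ω | IsPNE (fun i r => u i r ω) s}).map
      (fun ω => ∑ i, u i s ω)) t = tieMoment μ t ^ n := fun s => by
    rw [mgf_id_map (hsum s).aemeasurable, mgf_sum_restrict_isPNE hm hlaw hindep]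
  -- `mgf` is `0` by default when the exponential is not integrable; positivity of `tieMoment μ t`
  -- excludes this.
  have h2 : ∀ s, Integrable (fun y => Real.exp (t * id y))
      ((P.restrict {ω | IsPNE (fun i r => u i r ω) s}).map (fun ω => ∑ i, u i s ω)) := fun s => by
    by_contra hc
    have h3 := h1 s
    rw [mgf_undef hc] at h3
    exact (pow_pos ht n).ne h3
  rw [mgf, intensity, integral_finsetSum_measure fun s _ => h2 s]
  refine (Finset.sum_congr rfl fun s _ => h1 s).trans ?_
  simp [mul_pow]

end Game
-- The conditional law and the growth rate
section OneDim

variable {μ : Measure ℝ} [IsProbabilityMeasure μ]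

lemma measurableSet_snd_le_fst : MeasurableSet {p : ℝ × ℝ | p.2 ≤ p.1} :=
  measurableSet_le measurable_snd measurable_fst

variable (μ) in
-- By symmetry the two half-planes have equal mass; they cover the plane and meet in the diagonal.
lemma two_mul_measureReal_snd_le_fst :
    2 * (μ.prod μ).real {p | p.2 ≤ p.1} = 1 + tieProb μ := by
  have hswap : (μ.prod μ).real {p | p.1 ≤ p.2} = (μ.prod μ).real {p | p.2 ≤ p.1} := by
    conv_rhs => rw [← Measure.prod_swap]
    rw [map_measureReal_apply measurable_swap measurableSet_snd_le_fst]
    rfl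
  have hunion := measureReal_union_add_inter (μ := μ.prod μ) (s := {p : ℝ × ℝ | p.1 ≤ p.2})
    measurableSet_snd_le_fst
  have h1 : {p : ℝ × ℝ | p.1 ≤ p.2} ∪ {p | p.2 ≤ p.1} = Set.univ :=
    Set.eq_univ_of_forall fun p => le_total p.1 p.2
  have h2 : {p : ℝ × ℝ | p.1 ≤ p.2} ∩ {p | p.2 ≤ p.1} = {p | p.1 = p.2} := by
    ext p
    exact (le_antisymm_iff (a := p.1) (b := p.2)).symm
  rw [h1, h2, hswap, probReal_univ] at hunion
  rw [tieProb]
  linarith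

lemma measureReal_snd_le_fst_pos : 0 < (μ.prod μ).real {p | p.2 ≤ p.1} := by
  have h := two_mul_measureReal_snd_le_fst μ
  have : 0 ≤ tieProb μ := measureReal_nonneg
  linarith

instance isProbabilityMeasure_condLaw : IsProbabilityMeasure (condLaw μ) := by
  have : IsProbabilityMeasure (ProbabilityTheory.cond (μ.prod μ) {p | p.2 ≤ p.1}) :=
    cond_isProbabilityMeasure fun h => measureReal_snd_le_fst_pos.ne' (by
      rw [measureReal_def, h, ENNReal.toReal_zero])
  exact Measure.isProbabilityMeasure_map measurable_fst.aemeasurable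

lemma two_mul_tieMoment (t : ℝ) :
    2 * tieMoment μ t = (1 + tieProb μ) * mgf id (condLaw μ) t := by
  rw [condLaw, mgf_id_map measurable_fst.aemeasurable, ProbabilityTheory.cond, mgf_smul_measure,
    ← two_mul_measureReal_snd_le_fst, ENNReal.toReal_inv, ← measureReal_def, mul_assoc,
    mul_inv_cancel_left₀ measureReal_snd_le_fst_pos.ne']
  rfl

variable (hexp : ∀ t : ℝ, Integrable (fun x : ℝ => Real.exp (t * x)) μ)
include hexp

lemma integrable_exp_condLaw (t : ℝ) :
    Integrable (fun x : ℝ => Real.exp (t * x)) (condLaw μ) := by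
  rw [condLaw, integrable_map_measure (by fun_prop) measurable_fst.aemeasurable,
    ProbabilityTheory.cond]
  refine Integrable.smul_measure (((hexp t).comp_fst μ).restrict) ?_
  exact ENNReal.inv_ne_top.2 fun h => measureReal_snd_le_fst_pos.ne' (by
      rw [measureReal_def, h, ENNReal.toReal_zero])

lemma mgf_condLaw_pos (t : ℝ) : 0 < mgf id (condLaw μ) t := mgf_pos (integrable_exp_condLaw hexp t)

lemma mem_interior_integrableExpSet (t : ℝ) :
    t ∈ interior (integrableExpSet id (condLaw μ)) := by
  have : integrableExpSet id (condLaw μ) = Set.univ :=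
    Set.eq_univ_of_forall (integrable_exp_condLaw hexp)
  simp [this]

/-- Jensen's inequality, by integrating `1 + z ≤ exp z` at `z = t * (y - xtyp μ)`. -/
lemma exp_mul_xtyp_le (t : ℝ) : Real.exp (t * xtyp μ) ≤ mgf id (condLaw μ) t := by
  have hint : Integrable (fun y : ℝ => y) (condLaw μ) :=
    integrable_of_mem_interior_integrableExpSet (X := id) (mem_interior_integrableExpSet hexp 0)
  have e : Real.exp (t * xtyp μ) =
      ∫ y, Real.exp (t * xtyp μ) * (1 + t * (y - xtyp μ)) ∂(condLaw μ) := by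
    rw [integral_const_mul, integral_add (integrable_const _)
      (by exact (hint.sub (integrable_const _)).const_mul _), integral_const_mul,
      integral_sub hint (integrable_const _)]
    simp [xtyp]
  rw [e, mgf]
  refine integral_mono ?_ (integrable_exp_condLaw hexp t) fun y => ?_
  · exact ((integrable_const _).add ((hint.sub (integrable_const _)).const_mul _)).const_mul _
  · have h1 := Real.add_one_le_exp (t * (y - xtyp μ))
    have h2 : Real.exp (t * id y) = Real.exp (t * xtyp μ) * Real.exp (t * (y - xtyp μ)) := by
      rw [← Real.exp_add]
      congr 1
      simp only [id]
      ring
    simp only [h2]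
    exact mul_le_mul_of_nonneg_left (by linarith) (Real.exp_pos _).le

end OneDim

/-- The exponential growth rate of the exponential moment of the intensity of equilibria. -/
noncomputable def growth (μ : Measure ℝ) (t : ℝ) : ℝ :=
  Real.log (1 + tieProb μ) + cgf id (condLaw μ) t

/-- Exceeding a level strictly needs only one `t` in the supremum, so infinite values of the rate
need no separate treatment. -/
lemma log_lt_rate_iff (μ : Measure ℝ) (x : ℝ) :
    (Real.log (1 + tieProb μ) : EReal) < rate (condLaw μ) x ↔ ∃ t, growth μ t < t * x := by
  rw [rate, lt_iSup_iff]
  refine exists_congr fun t => ?_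
  rw [EReal.coe_lt_coe_iff, lt_sub_iff_add_lt, mul_comm x t]
  rfl

lemma xbeq_eq (μ : Measure ℝ) : xbeq μ = sInf (upperSet (growth μ) (xtyp μ)) := by
  simp only [xbeq, upperSet, log_lt_rate_iff]

lemma xweq_eq (μ : Measure ℝ) : xweq μ = sSup (lowerSet (growth μ) (xtyp μ)) := by
  simp only [xweq, lowerSet, log_lt_rate_iff]

section Growth

variable {μ : Measure ℝ} [IsProbabilityMeasure μ]

lemma growth_zero_pos (hα : 0 < tieProb μ) : 0 < growth μ 0 := by
  rw [growth, cgf_zero, add_zero]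
  exact Real.log_pos (by linarith)

variable (hexp : ∀ t : ℝ, Integrable (fun x : ℝ => Real.exp (t * x)) μ)
include hexp

lemma growth_zero_add_le (t : ℝ) : growth μ 0 + t * xtyp μ ≤ growth μ t := by
  rw [growth, growth, cgf_zero, add_zero, cgf]
  exact add_le_add_right
    ((Real.le_log_iff_exp_le (mgf_condLaw_pos hexp t)).2 (exp_mul_xtyp_le hexp t)) _

lemma differentiable_growth : Differentiable ℝ (growth μ) := fun t =>
  (analyticAt_cgf (mem_interior_integrableExpSet hexp t)).differentiableAt.const_add _

lemma hasDerivAt_growth_zero : HasDerivAt (growth μ) (xtyp μ) 0 := by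
  have h := (analyticAt_cgf (mem_interior_integrableExpSet hexp 0)).differentiableAt.hasDerivAt
  rw [deriv_cgf_zero (mem_interior_integrableExpSet hexp 0), probReal_univ, div_one] at h
  exact h.const_add _

lemma mgf_intensity_eq_exp {n : ℕ} {Ω : Type*} [MeasurableSpace Ω] {P : Measure Ω}
    [IsProbabilityMeasure P] {u : Fin n → Profile n → Ω → ℝ}
    (hm : ∀ i s, Measurable (u i s)) (hlaw : ∀ i s, P.map (u i s) = μ)
    (hindep : iIndepFun (fun q : Fin n × Profile n => u q.1 q.2) P) (t : ℝ) :
    mgf id (intensity u P) t = Real.exp (n * growth μ t) := by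
  have hα : 0 ≤ tieProb μ := measureReal_nonneg
  have hp : 0 < (1 + tieProb μ) * mgf id (condLaw μ) t :=
    mul_pos (by linarith) (mgf_condLaw_pos hexp t)
  have h2 := two_mul_tieMoment (μ := μ) t
  rw [mgf_intensity hm hlaw hindep (by linarith), h2, Real.exp_nat_mul, growth, Real.exp_add,
    Real.exp_log (by linarith), exp_cgf (X := id) (integrable_exp_condLaw hexp t)]

end Growth
-- From event counts to equilibria and their utilities
section Counting

variable {Ω ι : Type*} [Fintype ι] {E : ι → Set Ω} {ω : Ω}

lemma exists_mem_of_occurrences_pos (h : 0 < occurrences E ω) : ∃ s, ω ∈ E s := by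
  obtain ⟨s, -, hs⟩ := Finset.exists_ne_zero_of_sum_ne_zero h.ne'
  exact ⟨s, Set.mem_of_indicator_ne_zero hs⟩

lemma one_le_occurrences {s : ι} (h : ω ∈ E s) : 1 ≤ occurrences E ω := by
  have := Finset.single_le_sum (f := fun s => (E s).indicator (fun _ => (1 : ℝ)) ω)
    (fun s _ => Set.indicator_nonneg (fun _ _ => zero_le_one) _) (Finset.mem_univ s)
  rwa [Set.indicator_of_mem h] at this

open Classical in
lemma occurrences_pneEvent {n : ℕ} (u : Fin n → Profile n → Ω → ℝ) (B : Set ℝ) (ω : Ω) :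
    occurrences (pneEvent u B) ω =
      ((NE (fun i s => u i s ω)).filter fun s => ∑ i, u i s ω ∈ B).card := by
  rw [NE, Finset.filter_filter, Finset.card_filter, Nat.cast_sum]
  refine Finset.sum_congr rfl fun s _ => ?_
  by_cases h : ω ∈ pneEvent u B s
  · rw [Set.indicator_of_mem h, if_pos (by exact h), Nat.cast_one]
  · rw [Set.indicator_of_notMem h, if_neg (by exact h), Nat.cast_zero]

lemma occurrences_pneEvent_univ {n : ℕ} (u : Fin n → Profile n → Ω → ℝ) (ω : Ω) :
    occurrences (pneEvent u Set.univ) ω = (NE (fun i s => u i s ω)).card := by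
  simp [occurrences_pneEvent]

end Counting

section Deterministic

variable {n : ℕ}

lemma mem_NE {v : Game n} {s : Profile n} : s ∈ NE v ↔ IsPNE v s := by simp [NE]

lemma natCast_mul_ASU (hn : 0 < n) (v : Game n) (s : Profile n) : n * ASU v s = ∑ i, v i s := by
  rw [ASU, ← mul_assoc, mul_one_div_cancel (by positivity), one_mul]

lemma natCast_mul_le_sum_iff (hn : 0 < n) (v : Game n) (s : Profile n) (x : ℝ) :
    n * x ≤ ∑ i, v i s ↔ x ≤ ASU v s := by
  rw [← natCast_mul_ASU hn]
  exact mul_le_mul_iff_right₀ (by positivity)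

lemma sum_le_natCast_mul_iff (hn : 0 < n) (v : Game n) (s : Profile n) (x : ℝ) :
    ∑ i, v i s ≤ n * x ↔ ASU v s ≤ x := by
  rw [← natCast_mul_ASU hn]
  exact mul_le_mul_iff_right₀ (by positivity)

lemma finite_image_ASU (v : Game n) : (ASU v '' (NE v : Set (Profile n))).Finite :=
  (NE v).finite_toSet.image _

lemma abs_BEq_sub_le {v : Game n} {x δ : ℝ} (h1 : ∀ s, IsPNE v s → ASU v s ≤ x + δ)
    (h2 : ∃ s, IsPNE v s ∧ x - δ ≤ ASU v s) : |BEq v - x| ≤ δ := by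
  obtain ⟨s, hs, hxs⟩ := h2
  have hmem : ASU v s ∈ ASU v '' (NE v : Set (Profile n)) :=
    Set.mem_image_of_mem _ (mem_NE.2 hs)
  have hup : BEq v ≤ x + δ := csSup_le ⟨_, hmem⟩ (by
    rintro _ ⟨r, hr, rfl⟩
    exact h1 r (mem_NE.1 hr))
  have hlow : ASU v s ≤ BEq v := le_csSup (finite_image_ASU v).bddAbove hmem
  rw [abs_le]
  constructor <;> linarith

lemma abs_WEq_sub_le {v : Game n} {x δ : ℝ} (h1 : ∀ s, IsPNE v s → x - δ ≤ ASU v s)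
    (h2 : ∃ s, IsPNE v s ∧ ASU v s ≤ x + δ) : |WEq v - x| ≤ δ := by
  obtain ⟨s, hs, hxs⟩ := h2
  have hmem : ASU v s ∈ ASU v '' (NE v : Set (Profile n)) :=
    Set.mem_image_of_mem _ (mem_NE.2 hs)
  have hlow : x - δ ≤ WEq v := le_csInf ⟨_, hmem⟩ (by
    rintro _ ⟨r, hr, rfl⟩
    exact h1 r (mem_NE.1 hr))
  have hup : WEq v ≤ ASU v s := csInf_le (finite_image_ASU v).bddBelow hmem
  rw [abs_le]
  constructor <;> linarith

end Deterministic

/-! ### Limits in probability -/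

lemma tendsto_div_exp_nat_mul {c : ℝ} (hc : 0 < c) :
    Tendsto (fun n : ℕ => 4 * ((n + 1 : ℕ) : ℝ) / (Real.exp (n * c) / 2)) atTop (𝓝 0) := by
  have hr : 1 < Real.exp c := Real.one_lt_exp_iff.2 hc
  have h := ((tendsto_pow_const_div_const_pow_of_one_lt 1 hr).add
    (tendsto_pow_const_div_const_pow_of_one_lt 0 hr)).const_mul 8
  rw [add_zero, mul_zero] at h
  refine h.congr fun n => ?_
  rw [Real.exp_nat_mul]
  push_cast
  field_simp
  ring

section Sequence

variable {Ω : Type*} [MeasurableSpace Ω] {P : Measure Ω} [IsProbabilityMeasure P]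
  {u : (n : ℕ) → Fin n → Profile n → Ω → ℝ}

/-- The number of equilibria with total utility in `B n` is at least half its mean, with high
probability, if the mean grows exponentially. -/
lemma tendsto_occurrences_le_half (hm : ∀ n i s, Measurable (u n i s))
    (hindep : ∀ n, iIndepFun (fun q : Fin n × Profile n => u n q.1 q.2) P) {B : ℕ → Set ℝ}
    (hB : ∀ n, MeasurableSet (B n)) {c : ℝ} (hc : 0 < c)
    (h : ∀ᶠ n : ℕ in atTop, Real.exp (n * c) / 2 ≤ (intensity (u n) P).real (B n)) :
    Tendsto (fun n => P.real {ω | occurrences (pneEvent (u n) (B n)) ω ≤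
      (intensity (u n) P).real (B n) / 2}) atTop (𝓝 0) := by
  refine squeeze_zero' (Eventually.of_forall fun n => measureReal_nonneg) ?_
    (tendsto_div_exp_nat_mul hc)
  filter_upwards [h] with n hn
  have hpos : 0 < Real.exp (n * c) / 2 := by positivity
  have e := intensity_real_apply (P := P) (hm n) (hB n)
  have key := measureReal_occurrences_pneEvent_le_half (hm n) (hindep n) (hB n)
    (by rw [← e]; exact hpos.trans_le hn)
  rw [← e] at key
  exact key.trans (div_le_div_of_nonneg_left (by positivity) hpos hn)

lemma tendsto_occurrences_nonpos (hm : ∀ n i s, Measurable (u n i s))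
    (hindep : ∀ n, iIndepFun (fun q : Fin n × Profile n => u n q.1 q.2) P) {B : ℕ → Set ℝ}
    (hB : ∀ n, MeasurableSet (B n)) {c : ℝ} (hc : 0 < c)
    (h : ∀ᶠ n : ℕ in atTop, Real.exp (n * c) / 2 ≤ (intensity (u n) P).real (B n)) :
    Tendsto (fun n => P.real {ω | occurrences (pneEvent (u n) (B n)) ω ≤ 0}) atTop (𝓝 0) := by
  refine squeeze_zero (fun _ => measureReal_nonneg) (fun n => measureReal_mono fun ω hω => ?_)
    (tendsto_occurrences_le_half hm hindep hB hc h)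
  have h0 : occurrences (pneEvent (u n) (B n)) ω ≤ 0 := hω
  exact h0.trans (by positivity)

lemma tendsto_one_le_occurrences (hm : ∀ n i s, Measurable (u n i s)) {B : ℕ → Set ℝ}
    (hB : ∀ n, MeasurableSet (B n))
    (h : Tendsto (fun n => (intensity (u n) P).real (B n)) atTop (𝓝 0)) :
    Tendsto (fun n => P.real {ω | 1 ≤ occurrences (pneEvent (u n) (B n)) ω}) atTop (𝓝 0) := by
  refine squeeze_zero (fun _ => measureReal_nonneg) (fun n => ?_) h
  rw [intensity_real_apply (hm n) (hB n)]
  have := mul_measureReal_le_occurrences_le (P := P) (E := pneEvent (u n) (B n))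
    (fun _ => measurableSet_pneEvent (hB n) fun q _ => hm n q.1 q.2) 1
  rwa [one_mul] at this

variable {μ : Measure ℝ} [IsProbabilityMeasure μ]

section

variable (hexp : ∀ t : ℝ, Integrable (fun x : ℝ => Real.exp (t * x)) μ) (hα : 0 < tieProb μ)
  (hm : ∀ n i s, Measurable (u n i s)) (hlaw : ∀ n i s, P.map (u n i s) = μ)
  (hindep : ∀ n, iIndepFun (fun q : Fin n × Profile n => u n q.1 q.2) P)
include hexp hα hm hlaw hindep

lemma tendsto_card_NE_le_half :
    Tendsto (fun n => P.real {ω | occurrences (pneEvent (u n) Set.univ) ω ≤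
      (intensity (u n) P).real Set.univ / 2}) atTop (𝓝 0) := by
  refine tendsto_occurrences_le_half hm hindep (fun _ => MeasurableSet.univ)
    (growth_zero_pos hα) (Eventually.of_forall fun n => ?_)
  have : (intensity (u n) P).real Set.univ = Real.exp (n * growth μ 0) := by
    rw [← mgf_intensity_eq_exp hexp (hm n) (hlaw n) (hindep n), mgf_zero']
  rw [this]
  linarith [Real.exp_pos (n * growth μ 0)]

lemma tendsto_measureReal_NE_empty :
    Tendsto (fun n => P.real {ω | ¬ (NE (fun i s => u n i s ω)).Nonempty}) atTop (𝓝 0) := by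
  refine squeeze_zero (fun _ => measureReal_nonneg) (fun n => measureReal_mono fun ω hω => ?_)
    (tendsto_card_NE_le_half hexp hα hm hlaw hindep)
  have h0 : occurrences (pneEvent (u n) Set.univ) ω = 0 := by
    rw [occurrences_pneEvent_univ, Finset.not_nonempty_iff_eq_empty.1 hω]
    simp
  show occurrences (pneEvent (u n) Set.univ) ω ≤ _
  rw [h0]
  positivity

/-- The first moment excludes equilibria above `xbeq μ + δ`; the second moment provides one above
`xbeq μ - δ`. -/
lemma tendsto_lt_abs_BEq_sub {δ : ℝ} (hδ : 0 < δ) :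
    Tendsto (fun n => P.real {ω | δ < |BEq (fun i s => u n i s ω) - xbeq μ|}) atTop (𝓝 0) := by
  have hW : ∀ n t, mgf id (intensity (u n) P) t = Real.exp (n * growth μ t) := fun n =>
    mgf_intensity_eq_exp hexp (hm n) (hlaw n) (hindep n)
  have hB : ∀ (x : ℝ) (n : ℕ), MeasurableSet {y : ℝ | n * x ≤ y} := fun x n =>
    measurableSet_le measurable_const measurable_id
  have t1 := tendsto_one_le_occurrences hm (hB (xbeq μ + δ))
    (tendsto_upper_tail hW (growth_zero_pos hα) (growth_zero_add_le hexp)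
      (by rw [← xbeq_eq]; linarith))
  obtain ⟨c, hc, hev⟩ := eventually_exp_le_upper_tail hW (differentiable_growth hexp)
    (hasDerivAt_growth_zero hexp) (growth_zero_pos hα) (x := xbeq μ - δ)
    (by rw [← xbeq_eq]; linarith)
  have t2 := tendsto_occurrences_nonpos hm hindep (hB (xbeq μ - δ)) hc hev
  have t3 := t1.add t2
  rw [add_zero] at t3
  refine squeeze_zero' (Eventually.of_forall fun _ => measureReal_nonneg) ?_ t3
  filter_upwards [eventually_gt_atTop 0] with n hn
  refine (measureReal_mono ?_).trans (measureReal_union_le _ _)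
  intro ω hω
  by_contra hc
  rw [Set.mem_union, not_or] at hc
  refine absurd hω (not_lt.2 (abs_BEq_sub_le (fun s hs => ?_) ?_))
  · by_contra hlt
    exact hc.1 (one_le_occurrences (s := s)
      ⟨hs, (natCast_mul_le_sum_iff hn _ s _).2 (not_le.1 hlt).le⟩)
  · obtain ⟨s, hs, hs'⟩ := exists_mem_of_occurrences_pos (not_le.1 hc.2)
    exact ⟨s, hs, (natCast_mul_le_sum_iff hn _ s _).1 hs'⟩

lemma tendsto_lt_abs_WEq_sub {δ : ℝ} (hδ : 0 < δ) :
    Tendsto (fun n => P.real {ω | δ < |WEq (fun i s => u n i s ω) - xweq μ|}) atTop (𝓝 0) := by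
  have hW : ∀ n t, mgf id (intensity (u n) P) t = Real.exp (n * growth μ t) := fun n =>
    mgf_intensity_eq_exp hexp (hm n) (hlaw n) (hindep n)
  have hB : ∀ (x : ℝ) (n : ℕ), MeasurableSet {y : ℝ | y ≤ n * x} := fun x n =>
    measurableSet_le measurable_id measurable_const
  have t1 := tendsto_one_le_occurrences hm (hB (xweq μ - δ))
    (tendsto_lower_tail hW (growth_zero_pos hα) (growth_zero_add_le hexp)
      (by rw [← xweq_eq]; linarith))
  obtain ⟨c, hc, hev⟩ := eventually_exp_le_lower_tail hW (differentiable_growth hexp)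
    (hasDerivAt_growth_zero hexp) (growth_zero_pos hα) (x := xweq μ + δ)
    (by rw [← xweq_eq]; linarith)
  have t2 := tendsto_occurrences_nonpos hm hindep (hB (xweq μ + δ)) hc hev
  have t3 := t1.add t2
  rw [add_zero] at t3
  refine squeeze_zero' (Eventually.of_forall fun _ => measureReal_nonneg) ?_ t3
  filter_upwards [eventually_gt_atTop 0] with n hn
  refine (measureReal_mono ?_).trans (measureReal_union_le _ _)
  intro ω hω
  by_contra hc
  rw [Set.mem_union, not_or] at hc
  refine absurd hω (not_lt.2 (abs_WEq_sub_le (fun s hs => ?_) ?_))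
  · by_contra hlt
    exact hc.1 (one_le_occurrences (s := s)
      ⟨hs, (sum_le_natCast_mul_iff hn _ s _).2 (not_le.1 hlt).le⟩)
  · obtain ⟨s, hs, hs'⟩ := exists_mem_of_occurrences_pos (not_le.1 hc.2)
    exact ⟨s, hs, (sum_le_natCast_mul_iff hn _ s _).1 hs'⟩

lemma tendstoInMeasure_BEq_WEq :
    TendstoInMeasure P
      (fun n ω => (BEq (fun i s => u n i s ω), WEq (fun i s => u n i s ω)))
      atTop (fun _ => (xbeq μ, xweq μ)) := by
  rw [tendstoInMeasure_iff_measureReal_dist]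
  intro ε hε
  have h := (tendsto_lt_abs_BEq_sub hexp hα hm hlaw hindep (half_pos hε)).add
    (tendsto_lt_abs_WEq_sub hexp hα hm hlaw hindep (half_pos hε))
  rw [add_zero] at h
  refine squeeze_zero (fun _ => measureReal_nonneg) (fun n => ?_) h
  refine (measureReal_mono ?_).trans (measureReal_union_le _ _)
  intro ω hω
  -- The distance on the product is the maximum of the coordinate distances.
  rcases le_max_iff.1 (show ε ≤ max _ _ from hω) with h | h
  · left
    exact (half_lt_self hε).trans_le h
  · right
    exact (half_lt_self hε).trans_le h

lemma tendstoInMeasure_NEnear {ε : ℝ} (hε : 0 < ε) :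
    TendstoInMeasure P
      (fun n ω => ((NEnear (fun i s => u n i s ω) (xtyp μ) ε).card : ℝ) /
        ((NE (fun i s => u n i s ω)).card : ℝ))
      atTop (fun _ => (1 : ℝ)) := by
  classical
  rw [tendstoInMeasure_iff_measureReal_dist]
  intro η hη
  have hW : ∀ n t, mgf id (intensity (u n) P) t = Real.exp (n * growth μ t) := fun n =>
    mgf_intensity_eq_exp hexp (hm n) (hlaw n) (hindep n)
  set far : ℕ → Set ℝ := fun n => {y | n * ε ≤ |y - n * xtyp μ|} with hfar
  have hB : ∀ n, MeasurableSet (far n) := fun n =>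
    measurableSet_le measurable_const (by fun_prop)
  have t1 := tendsto_card_NE_le_half hexp hα hm hlaw hindep
  have t2 := (tendsto_relative_far hW (hasDerivAt_growth_zero hexp) hε).const_mul (2 / η)
  have t3 := t1.add t2
  rw [mul_zero, add_zero] at t3
  refine squeeze_zero' (Eventually.of_forall fun _ => measureReal_nonneg) ?_ t3
  filter_upwards [eventually_gt_atTop 0] with n hn
  set M := (intensity (u n) P).real Set.univ with hM
  have hMpos : 0 < M := by
    rw [hM, show (intensity (u n) P).real Set.univ = Real.exp (n * growth μ 0) by
      rw [← hW, mgf_zero']]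
    exact Real.exp_pos _
  -- The threshold matches the event that the total count exceeds `M / 2`: then fewer than `η * M /
  -- 2` far equilibria make a proportion below `η`.
  have hmarkov : P.real {ω | η * M / 2 ≤ occurrences (pneEvent (u n) (far n)) ω} ≤
      2 / η * ((intensity (u n) P).real (far n) / M) := by
    have := mul_measureReal_le_occurrences_le (P := P) (E := pneEvent (u n) (far n))
      (fun _ => measurableSet_pneEvent (hB n) fun q _ => hm n q.1 q.2) (η * M / 2)
    rw [← intensity_real_apply (hm n) (hB n)] at this
    rw [div_mul_div_comm, le_div_iff₀ (by positivity)]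
    linarith
  refine (measureReal_mono ?_).trans ((measureReal_union_le _ _).trans
    (add_le_add le_rfl hmarkov))
  intro ω hω
  by_contra hc
  rw [Set.mem_union, not_or] at hc
  obtain ⟨h1, h2⟩ := hc
  have h1 : M / 2 < occurrences (pneEvent (u n) Set.univ) ω := not_le.1 h1
  have h2 : occurrences (pneEvent (u n) (far n)) ω < η * M / 2 := not_le.1 h2
  rw [occurrences_pneEvent_univ] at h1
  set v : Game n := fun i s => u n i s ω with hv
  have hsplit : ((NEnear v (xtyp μ) ε).card : ℝ) + occurrences (pneEvent (u n) (far n)) ω =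
      (NE v).card := by
    rw [occurrences_pneEvent, ← Nat.cast_add,
      ← Finset.card_filter_add_card_filter_not (s := NE v) (fun s => |ASU v s - xtyp μ| < ε)]
    congr 3
    refine Finset.filter_congr fun s _ => ?_
    have e : ∑ i, v i s - n * xtyp μ = n * (ASU v s - xtyp μ) := by
      rw [← natCast_mul_ASU hn]; ring
    show n * ε ≤ |∑ i, v i s - n * xtyp μ| ↔ _
    rw [e, abs_mul, Nat.abs_cast, mul_le_mul_iff_right₀ (by positivity), not_lt]
  have hN : 0 < ((NE v).card : ℝ) := lt_trans (by positivity) h1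
  have hd : η ≤ |((NEnear v (xtyp μ) ε).card : ℝ) / (NE v).card - 1| := hω
  have e : ((NEnear v (xtyp μ) ε).card : ℝ) / (NE v).card - 1 =
      -(occurrences (pneEvent (u n) (far n)) ω / (NE v).card) := by
    rw [← hsplit] at hN ⊢
    field_simp
    ring
  rw [e, abs_neg, abs_of_nonneg (div_nonneg (occurrences_nonneg _ _) hN.le),
    le_div_iff₀ hN] at hd
  nlinarith

end

end Sequence

end RandomGame

theorem theorem2p3 {Ω : Type*} [MeasurableSpace Ω] (P : Measure Ω) [IsProbabilityMeasure P]
    (μ : Measure ℝ) [IsProbabilityMeasure μ]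
    (hexp : ∀ t : ℝ, Integrable (fun x : ℝ => Real.exp (t * x)) μ)
    (hα : 0 < RandomGame.tieProb μ)
    (u : (n : ℕ) → Fin n → RandomGame.Profile n → Ω → ℝ)
    (hlaw : ∀ n i s, HasLaw (u n i s) μ P)
    (hindep : ∀ n, iIndepFun (fun q : Fin n × RandomGame.Profile n => u n q.1 q.2) P) :
    -- with probability tending to one there is an equilibrium, so that the values given to
    -- `BEq`, `WEq` and to the ratio below in the absence of equilibria do not matter
    Tendsto (fun n => P {ω | (RandomGame.NE (fun i s => u n i s ω)).Nonempty}) atTop (𝓝 1) ∧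
    TendstoInMeasure P
      (fun n ω => (RandomGame.BEq (fun i s => u n i s ω), RandomGame.WEq (fun i s => u n i s ω)))
      atTop (fun _ => (RandomGame.xbeq μ, RandomGame.xweq μ)) ∧
    ∀ ε : ℝ, 0 < ε →
      TendstoInMeasure P
        (fun n ω =>
          ((RandomGame.NEnear (fun i s => u n i s ω) (RandomGame.xtyp μ) ε).card : ℝ) /
            ((RandomGame.NE (fun i s => u n i s ω)).card : ℝ))
        atTop (fun _ => (1 : ℝ)) := by
  -- The payoffs are only almost everywhere measurable. Each game has finitely many of them, so
  -- measurable versions give almost surely the same game.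
  obtain ⟨w, hm, hae⟩ : ∃ w : (n : ℕ) → Fin n → RandomGame.Profile n → Ω → ℝ,
      (∀ n i s, Measurable (w n i s)) ∧ ∀ n i s, u n i s =ᵐ[P] w n i s :=
    ⟨fun n i s => (hlaw n i s).aemeasurable.mk,
      fun n i s => (hlaw n i s).aemeasurable.measurable_mk,
      fun n i s => (hlaw n i s).aemeasurable.ae_eq_mk⟩
  have hgame : ∀ n, ∀ᵐ ω ∂P, (fun i s => w n i s ω) = fun i s => u n i s ω := fun n => by
    have : ∀ᵐ ω ∂P, ∀ i s, u n i s ω = w n i s ω :=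
      ae_all_iff.2 fun i => ae_all_iff.2 fun s => hae n i s
    filter_upwards [this] with ω hω
    funext i s
    exact (hω i s).symm
  have hl : ∀ n i s, P.map (w n i s) = μ := fun n i s => by
    rw [← Measure.map_congr (hae n i s), (hlaw n i s).map_eq]
  have hi : ∀ n, iIndepFun (fun q : Fin n × RandomGame.Profile n => w n q.1 q.2) P := fun n =>
    (iIndepFun_congr fun q : Fin n × RandomGame.Profile n => hae n q.1 q.2).1 (hindep n)
  refine ⟨?_, ?_, fun ε hε => ?_⟩
  · have h0 := RandomGame.tendsto_measureReal_NE_empty hexp hα hm hl hi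
    have hmeas : ∀ n, MeasurableSet {ω | (RandomGame.NE (fun i s => w n i s ω)).Nonempty} := by
      intro n
      have e : {ω | (RandomGame.NE (fun i s => w n i s ω)).Nonempty} =
          ⋃ s, RandomGame.pneEvent (w n) Set.univ s := by
        ext ω
        simp [Finset.Nonempty, RandomGame.mem_NE, RandomGame.pneEvent]
      rw [e]
      exact MeasurableSet.iUnion fun s =>
        RandomGame.measurableSet_pneEvent MeasurableSet.univ fun q _ => hm n q.1 q.2
    -- Complements are taken for the measurable version `w`, where the event is known to be
    -- measurable.
    have e : ∀ n, P {ω | (RandomGame.NE (fun i s => u n i s ω)).Nonempty} = ENNReal.ofReal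
        (1 - P.real {ω | ¬ (RandomGame.NE (fun i s => w n i s ω)).Nonempty}) := by
      intro n
      have h1 := probReal_compl_eq_one_sub (μ := P) (hmeas n)
      rw [Set.compl_ofPred] at h1
      rw [h1, sub_sub_cancel, ofReal_measureReal]
      refine measure_congr ?_
      filter_upwards [hgame n] with ω hω
      show (RandomGame.NE _).Nonempty = (RandomGame.NE _).Nonempty
      rw [hω]
    simp_rw [e]
    have h2 := ENNReal.tendsto_ofReal (h0.const_sub 1)
    simpa using h2
  · refine (RandomGame.tendstoInMeasure_BEq_WEq hexp hα hm hl hi).congr_left fun n => ?_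
    filter_upwards [hgame n] with ω hω
    rw [hω]
  · refine (RandomGame.tendstoInMeasure_NEnear hexp hα hm hl hi hε).congr_left fun n => ?_
    filter_upwards [hgame n] with ω hω
    rw [hω]
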